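/- Let $N$ be a smooth (Hausdorff) manifold of dimension $n$. An almost contact metric structure $(g,\xi,\eta,\varphi)$ on $N$ consists of a Riemannian metric $g$, a unit vector field $\xi$, the $1$-form $\eta=g(\xi,\cdot)$ and a bundle endomorphism $\varphi$ of $TN$ (all smooth) such that $\varphi(\xi)=0$, $\varphi^2=-1+\eta\otimes\xi$ and $g(\varphi X,\varphi Y)=g(X,Y)-\eta(X)\eta(Y)$. Its fundamental $2$-form is $F(X,Y)=g(\varphi X,Y)$. It is normal if $$[\varphi X,\varphi Y]+\varphi^2[X,Y]-\varphi[\varphi X,Y]-\varphi[X,\varphi Y]+d\eta(X,Y)\,\xi=0$$ for all vector fields $X,Y$, where $d\eta(X,Y)=X(\eta(Y))-Y(\eta(X))-\eta([X,Y])$. An ST (Sasaki with torsion) manifold is a manifold with a normal almost contact metric structure such that $\xi$ is a Killing vector field, $\mathcal L_\xi g=0$. A quasi-Sasaki manifold is a manifold with a normal almost contact metric structure such that $dF=0$. The torsion $3$-form is $c=\eta\wedge d\eta+dF(\varphi\cdot,\varphi\cdot,\varphi\cdot)$, the Lee $1$-form is $\vartheta(X)=-\frac12\sum_{i=1}^n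 c(\varphi X,E_i,\varphi E_i)$ for any local orthonormal frame $E_1,\dots,E_n$ (it does not depend on the frame), and an ST manifold is balanced if $\vartheta=0$ identically. **Proposition.** On every $5$-dimensional ST manifold $(N,g,\xi,\eta,\varphi)$ one has $dF=\vartheta\wedge F$, and the manifold is balanced if and only if it is quasi-Sasaki. -/

import Mathlib

open Bundle
open scoped Manifold ContDiff

noncomputable section

/-- The exterior derivative of a differential `k`-form `θ` on a smooth `n`-manifold: at `p`, pull
`θ` back to the model space along the inverse of the chart at `p`, take the exterior derivative
there, and pull the result back to `T_pM` along the chart. The normalization is the one in which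
`dη(X, Y) = X(η(Y)) - Y(η(X)) - η([X, Y])`. -/
def formExtDeriv {n : ℕ} {M : Type*} [TopologicalSpace M]
    [ChartedSpace (EuclideanSpace ℝ (Fin n)) M] {k : ℕ}
    (θ : ∀ p : M, TangentSpace (𝓡 n) p [⋀^Fin k]→L[ℝ] ℝ) (p : M) :
    TangentSpace (𝓡 n) p [⋀^Fin (k + 1)]→L[ℝ] ℝ :=
  ContinuousAlternatingMap.compContinuousLinearMap
    (extDeriv (E := EuclideanSpace ℝ (Fin n)) (F := ℝ)
      (fun y => (θ ((extChartAt (𝓡 n) p).symm y)).compContinuousLinearMap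
        (mfderiv (𝓡 n) (𝓡 n) (extChartAt (𝓡 n) p).symm y))
      (extChartAt (𝓡 n) p p))
    (mfderiv (𝓡 n) (𝓡 n) (extChartAt (𝓡 n) p) p)

/-- The wedge product of a `1`-form and a `2`-form on a vector space, evaluated on three vectors:
`(α ∧ β)(X, Y, Z) = α(X) β(Y, Z) + α(Y) β(Z, X) + α(Z) β(X, Y)`. -/
def wedgeOneTwo {V : Type*} (α : V → ℝ) (β : V → V → ℝ) (X Y Z : V) : ℝ :=
  α X * β Y Z + α Y * β Z X + α Z * β X Y

/-- An almost contact metric structure `(g, ξ, η, φ)` on a smooth `n`-manifold `M`, with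
`η = g(ξ, ·)`. All the data are smooth. (The axioms force `n` to be odd if `M` is nonempty.) -/
structure AlmostContactMetric (n : ℕ) (M : Type*) [TopologicalSpace M]
    [ChartedSpace (EuclideanSpace ℝ (Fin n)) M] [IsManifold (𝓡 n) ∞ M] where
  /-- the Riemannian metric -/
  g : ContMDiffRiemannianMetric (𝓡 n) ∞ (EuclideanSpace ℝ (Fin n))
    (fun p : M => TangentSpace (𝓡 n) p)
  /-- the Reeb vector field -/
  ξ : ContMDiffSection (𝓡 n) (EuclideanSpace ℝ (Fin n)) ∞ (fun p : M => TangentSpace (𝓡 n) p)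
  /-- the bundle endomorphism of the tangent bundle -/
  φ : ContMDiffSection (𝓡 n) (EuclideanSpace ℝ (Fin n) →L[ℝ] EuclideanSpace ℝ (Fin n)) ∞
    (fun p : M => TangentSpace (𝓡 n) p →L[ℝ] TangentSpace (𝓡 n) p)
  unit_ξ : ∀ p : M, g.inner p (ξ p) (ξ p) = 1
  φ_ξ : ∀ p : M, φ p (ξ p) = 0
  φ_sq : ∀ (p : M) (X : TangentSpace (𝓡 n) p), φ p (φ p X) = -X + g.inner p (ξ p) X • ξ p
  compat : ∀ (p : M) (X Y : TangentSpace (𝓡 n) p),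
    g.inner p (φ p X) (φ p Y) = g.inner p X Y - g.inner p (ξ p) X * g.inner p (ξ p) Y

namespace AlmostContactMetric

variable {n : ℕ} {M : Type*} [TopologicalSpace M]
  [ChartedSpace (EuclideanSpace ℝ (Fin n)) M] [IsManifold (𝓡 n) ∞ M]

/-- The `1`-form `η = g(ξ, ·)`. -/
def η (A : AlmostContactMetric n M) (p : M) : TangentSpace (𝓡 n) p [⋀^Fin 1]→L[ℝ] ℝ :=
  ContinuousAlternatingMap.ofSubsingleton ℝ (TangentSpace (𝓡 n) p) ℝ (0 : Fin 1)
    (A.g.inner p (A.ξ p))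

theorem η_φ (A : AlmostContactMetric n M) (p : M) (X : TangentSpace (𝓡 n) p) :
    A.g.inner p (A.ξ p) (A.φ p X) = 0 := by
  have h := A.φ_sq p (A.φ p X)
  rw [A.φ_sq p X, map_add, map_neg, map_smul, A.φ_ξ, smul_zero, add_zero] at h
  have h2 : A.g.inner p (A.ξ p) (A.φ p X) • A.ξ p = 0 := by simpa using h
  have h3 := congrArg (A.g.inner p (A.ξ p)) h2
  simpa [A.unit_ξ p] using h3

theorem inner_φ_self (A : AlmostContactMetric n M) (p : M) (X : TangentSpace (𝓡 n) p) :
    A.g.inner p (A.φ p X) X = 0 := by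
  have h := A.compat p X (A.φ p X)
  rw [A.φ_sq p X, A.η_φ, mul_zero, sub_zero, map_add, map_neg, map_smul,
    A.g.symm p (A.φ p X) (A.ξ p), A.η_φ, smul_zero, add_zero, A.g.symm p X] at h
  linarith

/-- The fundamental `2`-form `F(X, Y) = g(φ(X), Y)`. -/
def F (A : AlmostContactMetric n M) (p : M) : TangentSpace (𝓡 n) p [⋀^Fin 2]→L[ℝ] ℝ where
  toFun v := A.g.inner p (A.φ p (v 0)) (v 1)
  map_update_add' v i x y := by
    fin_cases i <;> simp
  map_update_smul' v i c x := by
    fin_cases i <;> simp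
  map_eq_zero_of_eq' v i j h hij := by
    have h01 : v 0 = v 1 := by
      fin_cases i <;> fin_cases j <;> simp_all
    simpa [h01] using A.inner_φ_self p (v 1)
  cont := by
    let G : EuclideanSpace ℝ (Fin n) →L[ℝ] EuclideanSpace ℝ (Fin n) →L[ℝ] ℝ :=
      (A.g.inner p).comp (A.φ p)
    have h : Continuous fun v : Fin 2 → EuclideanSpace ℝ (Fin n) => G (v 0) (v 1) := by fun_prop
    exact h

@[simp]
theorem F_apply (A : AlmostContactMetric n M) (p : M) (v : Fin 2 → TangentSpace (𝓡 n) p) :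
    A.F p v = A.g.inner p (A.φ p (v 0)) (v 1) := rfl

/-- The `2`-form `dη`. -/
def dη (A : AlmostContactMetric n M) (p : M) : TangentSpace (𝓡 n) p [⋀^Fin 2]→L[ℝ] ℝ :=
  formExtDeriv A.η p

/-- The `3`-form `dF`. -/
def dF (A : AlmostContactMetric n M) (p : M) : TangentSpace (𝓡 n) p [⋀^Fin 3]→L[ℝ] ℝ :=
  formExtDeriv A.F p

/-- The Sasaki–Hatakeyama tensor
`S(X, Y) = [φX, φY] + φ²[X, Y] - φ[φX, Y] - φ[X, φY] + dη(X, Y) ξ` of two vector fields. -/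
def sasakiHatakeyama (A : AlmostContactMetric n M) (X Y : ∀ p : M, TangentSpace (𝓡 n) p) (p : M) :
    TangentSpace (𝓡 n) p :=
  VectorField.mlieBracket (𝓡 n) (fun q => A.φ q (X q)) (fun q => A.φ q (Y q)) p
    + A.φ p (A.φ p (VectorField.mlieBracket (𝓡 n) X Y p))
    - A.φ p (VectorField.mlieBracket (𝓡 n) (fun q => A.φ q (X q)) Y p)
    - A.φ p (VectorField.mlieBracket (𝓡 n) X (fun q => A.φ q (Y q)) p)
    + A.dη p ![X p, Y p] • A.ξ p

/-- The structure is normal if the Sasaki–Hatakeyama tensor vanishes on all pairs of smooth vector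
fields. -/
def IsNormal (A : AlmostContactMetric n M) : Prop :=
  ∀ (X Y : ContMDiffSection (𝓡 n) (EuclideanSpace ℝ (Fin n)) ∞
      (fun p : M => TangentSpace (𝓡 n) p)) (p : M),
    A.sasakiHatakeyama X Y p = 0

/-- The derivative of a function `f` on `M` at `p` in the direction of `v ∈ T_pM`. -/
def dirDeriv (f : M → ℝ) (p : M) (v : TangentSpace (𝓡 n) p) : ℝ :=
  mfderiv (𝓡 n) 𝓘(ℝ, ℝ) f p v

/-- The Reeb field is a Killing field, `ℒ_ξ g = 0`, that is
`ξ(g(X, Y)) - g([ξ, X], Y) - g(X, [ξ, Y]) = 0` for all smooth vector fields `X`, `Y`. -/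
def IsKillingReeb (A : AlmostContactMetric n M) : Prop :=
  ∀ (X Y : ContMDiffSection (𝓡 n) (EuclideanSpace ℝ (Fin n)) ∞
      (fun p : M => TangentSpace (𝓡 n) p)) (p : M),
    dirDeriv (fun q => A.g.inner q (X q) (Y q)) p (A.ξ p)
      - A.g.inner p (VectorField.mlieBracket (𝓡 n) A.ξ X p) (Y p)
      - A.g.inner p (X p) (VectorField.mlieBracket (𝓡 n) A.ξ Y p) = 0

/-- An ST (Sasaki with torsion) structure: a normal almost contact metric structure whose Reeb
field is Killing. -/
structure IsST (A : AlmostContactMetric n M) : Prop where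
  normal : A.IsNormal
  killing : A.IsKillingReeb

/-- A quasi-Sasaki structure: a normal almost contact metric structure with closed fundamental
`2`-form. -/
structure IsQuasiSasaki (A : AlmostContactMetric n M) : Prop where
  normal : A.IsNormal
  closed : ∀ p : M, A.dF p = 0

/-- The torsion `3`-form `c = η ∧ dη + d^φ F`, where `d^φ F = dF(φ·, φ·, φ·)`. -/
def torsion (A : AlmostContactMetric n M) (p : M) (X Y Z : TangentSpace (𝓡 n) p) : ℝ :=
  wedgeOneTwo (fun U => A.η p ![U]) (fun U V => A.dη p ![U, V]) X Y Z
    + A.dF p ![A.φ p X, A.φ p Y, A.φ p Z]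

/-- `e` is an orthonormal basis of `T_pM` with respect to `g`. -/
def IsOrthonormalFrameAt (A : AlmostContactMetric n M) (p : M)
    (e : Fin n → TangentSpace (𝓡 n) p) : Prop :=
  ∀ i j, A.g.inner p (e i) (e j) = if i = j then 1 else 0

theorem sum_orthonormal_eq {V : Type*} [NormedAddCommGroup V] [InnerProductSpace ℝ V]
    [FiniteDimensional ℝ V] (hn : Module.finrank ℝ V = n) {e e' : Fin n → V}
    (he : Orthonormal ℝ e) (he' : Orthonormal ℝ e') (B : V →ₗ[ℝ] V →ₗ[ℝ] ℝ) :
    ∑ i, B (e i) (e i) = ∑ i, B (e' i) (e' i) := by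
  have hs : ∀ {f : Fin n → V}, Orthonormal ℝ f → ⊤ ≤ Submodule.span ℝ (Set.range f) := by
    intro f hf
    exact (hf.linearIndependent.span_eq_top_of_card_eq_finrank' (by simp [hn])).ge
  let b := OrthonormalBasis.mk he (hs he)
  let b' := OrthonormalBasis.mk he' (hs he')
  have hb : ∀ i, e i = b i := fun i => by simp [b]
  have hb' : ∀ i, e' i = b' i := fun i => by simp [b']
  simp only [hb, hb']
  calc ∑ i, B (b i) (b i) = ∑ i, ∑ j, inner ℝ (b' j) (b i) * B (b' j) (b i) := by
        refine Finset.sum_congr rfl fun i _ => ?_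
        conv_lhs => rw [← b'.sum_repr' (b i)]
        rw [b'.sum_repr' (b i)]
        conv_lhs => enter [1]; rw [← b'.sum_repr' (b i)]
        simp [map_sum, LinearMap.sum_apply]
    _ = ∑ j, ∑ i, inner ℝ (b' j) (b i) * B (b' j) (b i) := Finset.sum_comm
    _ = ∑ j, B (b' j) (b' j) := by
        refine Finset.sum_congr rfl fun j _ => ?_
        conv_rhs => enter [2]; rw [← b.sum_repr' (b' j)]
        simp [map_sum, real_inner_comm]

theorem exists_isOrthonormalFrameAt (A : AlmostContactMetric n M) (p : M) :
    ∃ e : Fin n → TangentSpace (𝓡 n) p, A.IsOrthonormalFrameAt p e := by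
  let core : InnerProductSpace.Core ℝ (TangentSpace (𝓡 n) p) := A.g.toRiemannianMetric.toCore p
  let _ : NormedAddCommGroup (TangentSpace (𝓡 n) p) := core.toNormedAddCommGroup
  let _ : InnerProductSpace ℝ (TangentSpace (𝓡 n) p) := InnerProductSpace.ofCore core.toCore
  have _ : FiniteDimensional ℝ (TangentSpace (𝓡 n) p) :=
    inferInstanceAs (FiniteDimensional ℝ (EuclideanSpace ℝ (Fin n)))
  have hn : Module.finrank ℝ (TangentSpace (𝓡 n) p) = n :=
    finrank_euclideanSpace_fin (𝕜 := ℝ) (n := n)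
  let b := (stdOrthonormalBasis ℝ (TangentSpace (𝓡 n) p)).reindex (finCongr hn)
  exact ⟨b, fun i j => orthonormal_iff_ite.mp b.orthonormal i j⟩

/-- An orthonormal basis of `T_pM`. -/
def orthonormalFrame (A : AlmostContactMetric n M) (p : M) : Fin n → TangentSpace (𝓡 n) p :=
  (A.exists_isOrthonormalFrameAt p).choose

/-- The Lee `1`-form `ϑ(X) = -1/2 ∑ᵢ c(φ(X), Eᵢ, φ(Eᵢ))`, for an orthonormal frame `E₁, …, Eₙ`.
The value does not depend on the frame, see `leeForm_eq`. -/
def leeForm (A : AlmostContactMetric n M) (p : M) (X : TangentSpace (𝓡 n) p) : ℝ :=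
  (-1 / 2) * ∑ i, A.torsion p (A.φ p X) (A.orthonormalFrame p i) (A.φ p (A.orthonormalFrame p i))

theorem leeForm_eq (A : AlmostContactMetric n M) (p : M) (X : TangentSpace (𝓡 n) p)
    {e : Fin n → TangentSpace (𝓡 n) p} (he : A.IsOrthonormalFrameAt p e) :
    A.leeForm p X = (-1 / 2) * ∑ i, A.torsion p (A.φ p X) (e i) (A.φ p (e i)) := by
  let core : InnerProductSpace.Core ℝ (TangentSpace (𝓡 n) p) := A.g.toRiemannianMetric.toCore p
  let _ : NormedAddCommGroup (TangentSpace (𝓡 n) p) := core.toNormedAddCommGroup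
  let _ : InnerProductSpace ℝ (TangentSpace (𝓡 n) p) := InnerProductSpace.ofCore core.toCore
  have _ : FiniteDimensional ℝ (TangentSpace (𝓡 n) p) :=
    inferInstanceAs (FiniteDimensional ℝ (EuclideanSpace ℝ (Fin n)))
  have hn : Module.finrank ℝ (TangentSpace (𝓡 n) p) = n :=
    finrank_euclideanSpace_fin (𝕜 := ℝ) (n := n)
  have u0 : ∀ a b x : TangentSpace (𝓡 n) p, Function.update ![a, b] 0 x = ![x, b] := by
    intro a b x; ext i : 1; fin_cases i <;> rfl
  have u1 : ∀ a b x : TangentSpace (𝓡 n) p, Function.update ![a, b] 1 x = ![a, x] := by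
    intro a b x; ext i : 1; fin_cases i <;> rfl
  have w1 : ∀ a b c x : TangentSpace (𝓡 n) p, Function.update ![a, b, c] 1 x = ![a, x, c] := by
    intro a b c x; ext i : 1; fin_cases i <;> rfl
  have w2 : ∀ a b c x : TangentSpace (𝓡 n) p, Function.update ![a, b, c] 2 x = ![a, b, x] := by
    intro a b c x; ext i : 1; fin_cases i <;> rfl
  have hη : ∀ x, A.η p ![x] = A.g.inner p (A.ξ p) x := fun x => rfl
  have hadd2 : ∀ U x y, A.dη p ![U, x + y] = A.dη p ![U, x] + A.dη p ![U, y] := fun U x y => by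
    have h := (A.dη p).map_update_add ![U, 0] 1 x y
    rwa [u1, u1, u1] at h
  have hadd1 : ∀ U x y, A.dη p ![x + y, U] = A.dη p ![x, U] + A.dη p ![y, U] := fun U x y => by
    have h := (A.dη p).map_update_add ![0, U] 0 x y
    rwa [u0, u0, u0] at h
  have hsmul2 : ∀ (c : ℝ) U x, A.dη p ![U, c • x] = c * A.dη p ![U, x] := fun c U x => by
    have h := (A.dη p).map_update_smul ![U, 0] 1 c x
    rwa [u1, u1] at h
  have hsmul1 : ∀ (c : ℝ) U x, A.dη p ![c • x, U] = c * A.dη p ![x, U] := fun c U x => by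
    have h := (A.dη p).map_update_smul ![0, U] 0 c x
    rwa [u0, u0] at h
  have haddF1 : ∀ U V x y, A.dF p ![U, x + y, V] = A.dF p ![U, x, V] + A.dF p ![U, y, V] :=
    fun U V x y => by
      have h := (A.dF p).map_update_add ![U, 0, V] 1 x y
      rwa [w1, w1, w1] at h
  have haddF2 : ∀ U V x y, A.dF p ![U, V, x + y] = A.dF p ![U, V, x] + A.dF p ![U, V, y] :=
    fun U V x y => by
      have h := (A.dF p).map_update_add ![U, V, 0] 2 x y
      rwa [w2, w2, w2] at h
  have hsmulF1 : ∀ (c : ℝ) U V x, A.dF p ![U, c • x, V] = c * A.dF p ![U, x, V] :=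
    fun c U V x => by
      have h := (A.dF p).map_update_smul ![U, 0, V] 1 c x
      rwa [w1, w1] at h
  have hsmulF2 : ∀ (c : ℝ) U V x, A.dF p ![U, V, c • x] = c * A.dF p ![U, V, x] :=
    fun c U V x => by
      have h := (A.dF p).map_update_smul ![U, V, 0] 2 c x
      rwa [w2, w2] at h
  let B : TangentSpace (𝓡 n) p →ₗ[ℝ] TangentSpace (𝓡 n) p →ₗ[ℝ] ℝ :=
    LinearMap.mk₂ ℝ (fun U V => A.torsion p (A.φ p X) U (A.φ p V))
      (fun x y V => by
        simp only [torsion, wedgeOneTwo, hη, map_add, hadd1, hadd2, haddF1]; ring)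
      (fun c x V => by
        simp only [torsion, wedgeOneTwo, hη, map_smul, hsmul1, hsmul2, hsmulF1, smul_eq_mul]; ring)
      (fun U x y => by
        simp only [torsion, wedgeOneTwo, hη, map_add, hadd1, hadd2, haddF2]; ring)
      (fun c U x => by
        simp only [torsion, wedgeOneTwo, hη, map_smul, hsmul1, hsmul2, hsmulF2, smul_eq_mul]; ring)
  have key := sum_orthonormal_eq hn
    (orthonormal_iff_ite.mpr fun i j => (A.exists_isOrthonormalFrameAt p).choose_spec i j)
    (orthonormal_iff_ite.mpr fun i j => he i j) B
  exact congrArg (fun t : ℝ => (-1 / 2) * t) key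

/-- The structure is balanced if its Lee form vanishes identically. -/
def IsBalanced (A : AlmostContactMetric n M) : Prop :=
  ∀ (p : M) (X : TangentSpace (𝓡 n) p), A.leeForm p X = 0

end AlmostContactMetric

end

/-!
Normality evaluated at `X = ξ`, together with the Killing equation, gives `ℒ_ξ φ = 0`, hence
`ℒ_ξ F = 0`. As `ι_ξ F = 0`, Cartan's formula yields `ι_ξ dF = 0`: the `3`-form `dF` lives on the
`4`-dimensional contact distribution `ker η`, where every `3`-form is the wedge product of a unique
`1`-form with `F`. In an adapted orthonormal frame `(ξ, u, φu, v, φv)` this `1`-form is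
`X ↦ dF(X, u, φu) + dF(X, v, φv)`, half the trace of `dF(X, ·, φ ·)`; and that is the Lee form,
because `η ∧ dη` contributes nothing to the trace defining it.
-/

section AlternatingMap

variable {R V N : Type*} [CommRing R] [AddCommGroup V] [Module R V] [AddCommGroup N] [Module R N]

theorem map_vecTwo_swap (T : V [⋀^Fin 2]→ₗ[R] N) (u v : V) : T ![u, v] = -T ![v, u] := by
  rw [← T.map_swap ![v, u] (i := 0) (j := 1) (by decide)]
  congr 1; ext i; fin_cases i <;> rfl

theorem map_vecThree_rotate (T : V [⋀^Fin 3]→ₗ[R] N) (u v w : V) :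
    T ![u, v, w] = T ![v, w, u] := by
  have h := T.map_perm ![u, v, w] (finRotate 3)
  have hrot : ![u, v, w] ∘ finRotate 3 = ![v, w, u] := by
    ext i; fin_cases i <;> rfl
  simpa [hrot, sign_finRotate] using h.symm

theorem map_vecThree_swap (T : V [⋀^Fin 3]→ₗ[R] N) (u v w : V) :
    T ![u, v, w] = -T ![u, w, v] := by
  have h := T.map_swap ![u, w, v] (i := 1) (j := 2) (by decide)
  rw [← h]
  congr 1; ext i; fin_cases i <;> rfl

theorem basis_ext_alternating_of_strictMono {ι : Type*} [LinearOrder ι] {k : ℕ}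
    {f g : V [⋀^Fin k]→ₗ[R] N} (b : Module.Basis ι R V)
    (h : ∀ v : Fin k → ι, StrictMono v → (f fun i => b (v i)) = g fun i => b (v i)) : f = g := by
  refine b.ext_alternating fun v hv => ?_
  have hsorted : StrictMono (v ∘ Tuple.sort v) :=
    (Tuple.monotone_sort v).strictMono_of_injective (hv.comp (Tuple.sort v).injective)
  have hperm := h _ hsorted
  change f ((fun i => b (v i)) ∘ Tuple.sort v) = g ((fun i => b (v i)) ∘ Tuple.sort v) at hperm
  rw [f.map_perm, g.map_perm] at hperm
  exact smul_left_cancel _ hperm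

/-- The linear form `X ↦ T(X, u, v)`, an iterated interior product of the `3`-form `T`. -/
def contractTwo (T : V [⋀^Fin 3]→ₗ[R] N) (u v : V) : V →ₗ[R] N where
  toFun X := T ![X, u, v]
  map_add' X Y := T.map_vecCons_add ![u, v] X Y
  map_smul' r X := T.map_vecCons_smul ![u, v] r X

/-- The wedge product of a linear form and an alternating bilinear form, as an alternating map. -/
def wedgeForm (α : V →ₗ[R] R) (β : V [⋀^Fin 2]→ₗ[R] R) : V [⋀^Fin 3]→ₗ[R] R :=
  AlternatingMap.alternatizeUncurryFin (α.smulRight β)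

theorem wedgeForm_apply (α : V →ₗ[R] R) (β : V [⋀^Fin 2]→ₗ[R] R) (X Y Z : V) :
    wedgeForm α β ![X, Y, Z] = α X * β ![Y, Z] - α Y * β ![X, Z] + α Z * β ![X, Y] := by
  have h0 : (0 : Fin 3).removeNth ![X, Y, Z] = ![Y, Z] := by ext i; fin_cases i <;> rfl
  have h1 : (1 : Fin 3).removeNth ![X, Y, Z] = ![X, Z] := by ext i; fin_cases i <;> rfl
  have h2 : (2 : Fin 3).removeNth ![X, Y, Z] = ![X, Y] := by ext i; fin_cases i <;> rfl
  simp [wedgeForm, AlternatingMap.alternatizeUncurryFin_apply, Fin.sum_univ_three, h0, h1, h2,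
    sub_eq_add_neg, -Fin.removeNth_zero]

theorem eq_wedgeForm_contractTwo (T : V [⋀^Fin 3]→ₗ[R] R) (β : V [⋀^Fin 2]→ₗ[R] R)
    (e : Module.Basis (Fin 5) R V) (hT : ∀ Y Z, T ![e 0, Y, Z] = 0)
    (hβ : ∀ i j, i < j → β ![e i, e j] = if i = 1 ∧ j = 2 ∨ i = 3 ∧ j = 4 then 1 else 0) :
    T = wedgeForm (contractTwo T (e 1) (e 2) + contractTwo T (e 3) (e 4)) β := by
  have triples : ∀ i j k : Fin 5, i < j → j < k → i = 0 ∨ (i = 1 ∧ j = 2 ∧ k = 3) ∨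
      (i = 1 ∧ j = 2 ∧ k = 4) ∨ (i = 1 ∧ j = 3 ∧ k = 4) ∨ (i = 2 ∧ j = 3 ∧ k = 4) := by decide
  have self_left : ∀ X Y, T ![X, X, Y] = 0 := fun X Y =>
    T.map_eq_zero_of_eq _ (i := 0) (j := 1) rfl (by decide)
  have self_outer : ∀ X Y, T ![X, Y, X] = 0 := fun X Y =>
    T.map_eq_zero_of_eq _ (i := 0) (j := 2) rfl (by decide)
  refine basis_ext_alternating_of_strictMono e fun w hw => ?_
  obtain ⟨h01, h12⟩ : w 0 < w 1 ∧ w 1 < w 2 := ⟨hw (by decide), hw (by decide)⟩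
  have hvec : (fun i => e (w i)) = ![e (w 0), e (w 1), e (w 2)] := by
    ext i : 1; fin_cases i <;> rfl
  rw [hvec, wedgeForm_apply, hβ _ _ h01, hβ _ _ h12, hβ _ _ (h01.trans h12)]
  rcases triples _ _ _ h01 h12 with h0 | ⟨hi, hj, hk⟩ | ⟨hi, hj, hk⟩ | ⟨hi, hj, hk⟩ | ⟨hi, hj, hk⟩
  · simp [h0, hT, contractTwo]
  · simp [hi, hj, hk, contractTwo, self_left, map_vecThree_rotate T (e 3)]
  · simp [hi, hj, hk, contractTwo, self_left, self_outer, map_vecThree_rotate T (e 4) (e 1) (e 2)]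
  · simp [hi, hj, hk, contractTwo, self_left, self_outer]
  · simp [hi, hj, hk, contractTwo, self_left, self_outer]

end AlternatingMap

theorem exists_unit_orthogonal {V : Type*} [AddCommGroup V] [Module ℝ V] [FiniteDimensional ℝ V]
    {B : V →ₗ[ℝ] V →ₗ[ℝ] ℝ} (hB : ∀ v, v ≠ 0 → 0 < B v v) {k : ℕ}
    (hk : k < Module.finrank ℝ V) (w : Fin k → V) : ∃ v, B v v = 1 ∧ ∀ i, B (w i) v = 0 := by
  have hker : LinearMap.ker (LinearMap.pi fun i => B (w i)) ≠ ⊥ :=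
    LinearMap.ker_ne_bot_of_finrank_lt (by simpa using hk)
  obtain ⟨v, hv, hv0⟩ := (Submodule.ne_bot_iff _).mp hker
  have horth : ∀ i, B (w i) v = 0 := congrFun (LinearMap.mem_ker.mp hv)
  refine ⟨(Real.sqrt (B v v))⁻¹ • v, ?_, fun i => by rw [map_smul, horth, smul_zero]⟩
  have hsqrt : Real.sqrt (B v v) ≠ 0 := (Real.sqrt_pos.mpr (hB v hv0)).ne'
  simp only [map_smul, LinearMap.smul_apply, smul_eq_mul]
  field_simp
  exact (Real.sq_sqrt (hB v hv0).le).symm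

namespace AlmostContactMetric

variable {n : ℕ} {M : Type*} [TopologicalSpace M]
  [ChartedSpace (EuclideanSpace ℝ (Fin n)) M] [IsManifold (𝓡 n) ∞ M]

theorem inner_φ_left (A : AlmostContactMetric n M) (p : M) (X Y : TangentSpace (𝓡 n) p) :
    A.g.inner p (A.φ p X) Y = -A.g.inner p X (A.φ p Y) := by
  have h := A.inner_φ_self p (X + Y)
  simp only [map_add, add_apply, A.inner_φ_self, zero_add, add_zero] at h
  rw [A.g.symm p X]
  exact eq_neg_of_add_eq_zero_left (by linarith)

theorem IsOrthonormalFrameAt.linearIndependent {A : AlmostContactMetric n M} {p : M}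
    {e : Fin n → TangentSpace (𝓡 n) p} (he : A.IsOrthonormalFrameAt p e) :
    LinearIndependent ℝ e := by
  refine Fintype.linearIndependent_iff.mpr fun c hc i => ?_
  have h := congrArg (A.g.inner p (e i)) hc
  simpa [map_sum, he i] using h

/-- An orthonormal frame at `p` as a basis of the tangent space. -/
noncomputable def IsOrthonormalFrameAt.basis {A : AlmostContactMetric n M} {p : M}
    {e : Fin n → TangentSpace (𝓡 n) p} (he : A.IsOrthonormalFrameAt p e) :
    Module.Basis (Fin n) ℝ (TangentSpace (𝓡 n) p) :=
  have : FiniteDimensional ℝ (TangentSpace (𝓡 n) p) :=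
    inferInstanceAs (FiniteDimensional ℝ (EuclideanSpace ℝ (Fin n)))
  basisOfLinearIndependentOfCardEqFinrank' e he.linearIndependent
    ((Fintype.card_fin n).trans (finrank_euclideanSpace_fin (𝕜 := ℝ)).symm)

@[simp]
theorem IsOrthonormalFrameAt.basis_apply {A : AlmostContactMetric n M} {p : M}
    {e : Fin n → TangentSpace (𝓡 n) p} (he : A.IsOrthonormalFrameAt p e) (i : Fin n) :
    he.basis i = e i := by
  simp [basis]

theorem IsOrthonormalFrameAt.sum_inner_smul {A : AlmostContactMetric n M} {p : M}
    {e : Fin n → TangentSpace (𝓡 n) p} (he : A.IsOrthonormalFrameAt p e)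
    (X : TangentSpace (𝓡 n) p) : ∑ i, A.g.inner p (e i) X • e i = X := by
  have hX : ∑ i, he.basis.repr X i • e i = X := by simpa using he.basis.sum_repr X
  have hcoord : ∀ i, A.g.inner p (e i) X = he.basis.repr X i := fun i => by
    conv_lhs => rw [← hX]
    simp [map_sum, he i]
  simpa only [hcoord] using hX

theorem map_φ_φ_of_map_ξ_eq_zero (A : AlmostContactMetric n M) (p : M)
    {T : TangentSpace (𝓡 n) p [⋀^Fin 3]→L[ℝ] ℝ} (hT : ∀ Y Z, T ![A.ξ p, Y, Z] = 0)
    (X Y Z : TangentSpace (𝓡 n) p) : T ![A.φ p (A.φ p X), Y, Z] = -T ![X, Y, Z] := by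
  have h : T ![-X + A.g.inner p (A.ξ p) X • A.ξ p, Y, Z] =
      T ![-X, Y, Z] + A.g.inner p (A.ξ p) X • T ![A.ξ p, Y, Z] := by
    rw [T.vecCons_add, T.vecCons_smul]
  rw [A.φ_sq, h, hT, smul_zero, add_zero, ← neg_one_smul ℝ X, T.vecCons_smul, neg_one_smul]

theorem map_self_φ_φ_of_map_ξ_eq_zero (A : AlmostContactMetric n M) (p : M)
    {T : TangentSpace (𝓡 n) p [⋀^Fin 3]→L[ℝ] ℝ} (hT : ∀ Y Z, T ![A.ξ p, Y, Z] = 0)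
    (X U : TangentSpace (𝓡 n) p) :
    T ![X, A.φ p U, A.φ p (A.φ p U)] = T ![X, U, A.φ p U] := by
  have hrot : ∀ U V W, T ![U, V, W] = T ![V, W, U] := map_vecThree_rotate T.toAlternatingMap
  have hswap : ∀ U V W, T ![U, V, W] = -T ![U, W, V] := map_vecThree_swap T.toAlternatingMap
  calc T ![X, A.φ p U, A.φ p (A.φ p U)] = T ![A.φ p (A.φ p U), X, A.φ p U] := (hrot _ _ _).symm
    _ = -T ![U, X, A.φ p U] := A.map_φ_φ_of_map_ξ_eq_zero p hT U X (A.φ p U)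
    _ = T ![X, U, A.φ p U] := by rw [hrot, hswap, neg_neg]

theorem torsion_φ_self_φ (A : AlmostContactMetric n M) (p : M)
    (hξ : ∀ Y Z, A.dF p ![A.ξ p, Y, Z] = 0) (X U : TangentSpace (𝓡 n) p) :
    A.torsion p (A.φ p X) U (A.φ p U) =
      A.g.inner p (A.ξ p) U * A.dη p ![A.φ p U, A.φ p X] - A.dF p ![X, U, A.φ p U] := by
  have hη : ∀ Y, A.η p ![Y] = A.g.inner p (A.ξ p) Y := fun _ => rfl
  rw [torsion, A.map_φ_φ_of_map_ξ_eq_zero p hξ, A.map_self_φ_φ_of_map_ξ_eq_zero p hξ, wedgeOneTwo,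
    hη, hη, hη, A.η_φ, A.η_φ]
  ring

theorem leeForm_eq_half_sum_dF (A : AlmostContactMetric n M) (p : M)
    (hξ : ∀ Y Z, A.dF p ![A.ξ p, Y, Z] = 0) (X : TangentSpace (𝓡 n) p)
    {e : Fin n → TangentSpace (𝓡 n) p} (he : A.IsOrthonormalFrameAt p e) :
    A.leeForm p X = 1 / 2 * ∑ i, A.dF p ![X, e i, A.φ p (e i)] := by
  have hdη : ∑ i, A.g.inner p (A.ξ p) (e i) * A.dη p ![A.φ p (e i), A.φ p X] = 0 := by
    let L : TangentSpace (𝓡 n) p →ₗ[ℝ] ℝ :=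
      { toFun Y := A.dη p ![A.φ p Y, A.φ p X]
        map_add' Y Z := by rw [map_add, (A.dη p).vecCons_add]
        map_smul' r Y := by rw [map_smul, (A.dη p).vecCons_smul]; rfl }
    calc ∑ i, A.g.inner p (A.ξ p) (e i) * L (e i) = L (∑ i, A.g.inner p (e i) (A.ξ p) • e i) := by
          simp only [map_sum, map_smul, smul_eq_mul, A.g.symm p (A.ξ p)]
      _ = A.dη p ![A.φ p (A.ξ p), A.φ p X] := by rw [he.sum_inner_smul]; rfl
      _ = 0 := by rw [A.φ_ξ]; exact (A.dη p).map_coord_zero 0 rfl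
  rw [A.leeForm_eq p X he]
  simp only [A.torsion_φ_self_φ p hξ, Finset.sum_sub_distrib, hdη]
  ring

theorem F_vecTwo (A : AlmostContactMetric n M) (p : M) (X Y : TangentSpace (𝓡 n) p) :
    A.F p ![X, Y] = A.g.inner p (A.φ p X) Y := rfl

section DimFive

variable {M : Type*} [TopologicalSpace M] [ChartedSpace (EuclideanSpace ℝ (Fin 5)) M]
  [IsManifold (𝓡 5) ∞ M] (A : AlmostContactMetric 5 M) (p : M)

theorem exists_adapted_frame :
    ∃ u v : TangentSpace (𝓡 5) p,
      A.IsOrthonormalFrameAt p ![A.ξ p, u, A.φ p u, v, A.φ p v] := by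
  have : FiniteDimensional ℝ (TangentSpace (𝓡 5) p) :=
    inferInstanceAs (FiniteDimensional ℝ (EuclideanSpace ℝ (Fin 5)))
  have hfinrank : Module.finrank ℝ (TangentSpace (𝓡 5) p) = 5 :=
    finrank_euclideanSpace_fin (𝕜 := ℝ) (n := 5)
  let B := (A.g.inner p).toLinearMap₁₂
  have hB : ∀ v, v ≠ 0 → 0 < B v v := A.g.pos p
  obtain ⟨u, huu : A.g.inner p u u = 1, hu⟩ :=
    exists_unit_orthogonal hB (by omega) ![A.ξ p]
  obtain ⟨v, hvv : A.g.inner p v v = 1, hv⟩ :=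
    exists_unit_orthogonal hB (by omega) ![A.ξ p, u, A.φ p u]
  have hξu : A.g.inner p (A.ξ p) u = 0 := hu 0
  have hξv : A.g.inner p (A.ξ p) v = 0 := hv 0
  have huv : A.g.inner p u v = 0 := hv 1
  have hφuv : A.g.inner p (A.φ p u) v = 0 := hv 2
  have huφv : A.g.inner p u (A.φ p v) = 0 := by
    rw [← neg_eq_zero, ← A.inner_φ_left, hφuv]
  have hφvu : A.g.inner p (A.φ p v) u = 0 := (A.g.symm p _ _).trans huφv
  have hsymm := A.g.symm p
  refine ⟨u, v, fun i j => ?_⟩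
  fin_cases i <;> fin_cases j <;>
    simp [A.unit_ξ, A.η_φ, huu, hvv, hξu, hξv, huv, hφuv, huφv, hφvu, A.inner_φ_self, A.compat,
      hsymm _ (A.ξ p), hsymm v u, hsymm v (A.φ p u), hsymm _ (A.φ p v), hsymm u (A.φ p u)]

variable {A p}

theorem F_adapted_frame {u v : TangentSpace (𝓡 5) p}
    (he : A.IsOrthonormalFrameAt p ![A.ξ p, u, A.φ p u, v, A.φ p v]) {i j : Fin 5} (hij : i < j) :
    A.F p ![(![A.ξ p, u, A.φ p u, v, A.φ p v] : Fin 5 → TangentSpace (𝓡 5) p) i,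
        (![A.ξ p, u, A.φ p u, v, A.φ p v] : Fin 5 → TangentSpace (𝓡 5) p) j] =
      if i = 1 ∧ j = 2 ∨ i = 3 ∧ j = 4 then 1 else 0 := by
  have hξu : A.g.inner p (A.ξ p) u = 0 := he 0 1
  have huv : A.g.inner p u v = 0 := he 1 3
  have huφv : A.g.inner p u (A.φ p v) = 0 := he 1 4
  have hφuφu : A.g.inner p (A.φ p u) (A.φ p u) = 1 := he 2 2
  have hφuv : A.g.inner p (A.φ p u) v = 0 := he 2 3
  have hφuφv : A.g.inner p (A.φ p u) (A.φ p v) = 0 := he 2 4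
  have hφvφv : A.g.inner p (A.φ p v) (A.φ p v) = 1 := he 4 4
  fin_cases i <;> fin_cases j <;>
    simp [A.F_vecTwo, A.φ_ξ, A.φ_sq p u, hξu, huv, huφv, hφuφu, hφuv, hφuφv, hφvφv] at hij ⊢

theorem leeForm_eq_of_adapted_frame (hξ : ∀ Y Z, A.dF p ![A.ξ p, Y, Z] = 0)
    {u v : TangentSpace (𝓡 5) p}
    (he : A.IsOrthonormalFrameAt p ![A.ξ p, u, A.φ p u, v, A.φ p v]) (X : TangentSpace (𝓡 5) p) :
    A.leeForm p X = A.dF p ![X, u, A.φ p u] + A.dF p ![X, v, A.φ p v] := by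
  have hzero : A.dF p ![X, A.ξ p, A.φ p (A.ξ p)] = 0 :=
    (A.dF p).map_coord_zero 2 (A.φ_ξ p)
  rw [A.leeForm_eq_half_sum_dF p hξ X he]
  simp only [Fin.sum_univ_five, Matrix.cons_val, hzero, A.map_self_φ_φ_of_map_ξ_eq_zero p hξ]
  ring

theorem dF_eq_wedgeOneTwo_leeForm (hξ : ∀ Y Z, A.dF p ![A.ξ p, Y, Z] = 0)
    (X Y Z : TangentSpace (𝓡 5) p) :
    A.dF p ![X, Y, Z] = wedgeOneTwo (A.leeForm p) (fun U V => A.F p ![U, V]) X Y Z := by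
  obtain ⟨u, v, he⟩ := A.exists_adapted_frame p
  let T := (A.dF p).toAlternatingMap
  let α := contractTwo T u (A.φ p u) + contractTwo T v (A.φ p v)
  have hα : ∀ W, α W = A.leeForm p W := fun W => (leeForm_eq_of_adapted_frame hξ he W).symm
  have hwedge : T = wedgeForm α (A.F p).toAlternatingMap := by
    have h := eq_wedgeForm_contractTwo T (A.F p).toAlternatingMap he.basis
      (by rw [he.basis_apply]; exact hξ)
      (fun i j hij => by rw [he.basis_apply, he.basis_apply]; exact F_adapted_frame he hij)
    simp only [he.basis_apply] at h
    exact h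
  have hswap : A.F p ![Z, X] = -A.F p ![X, Z] := map_vecTwo_swap (A.F p).toAlternatingMap Z X
  calc A.dF p ![X, Y, Z] = wedgeForm α (A.F p).toAlternatingMap ![X, Y, Z] :=
        congrArg (fun S => S ![X, Y, Z]) hwedge
    _ = _ := by
      rw [wedgeForm_apply, hα, hα, hα, wedgeOneTwo, hswap]
      simp only [ContinuousAlternatingMap.coe_toAlternatingMap]
      ring

end DimFive

end AlmostContactMetric

theorem differentiableAt_continuousAlternatingMap_of_apply {𝕜 E V F ι : Type*}
    [NontriviallyNormedField 𝕜] [CompleteSpace 𝕜] [NormedAddCommGroup E] [NormedSpace 𝕜 E]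
    [NormedAddCommGroup V] [NormedSpace 𝕜 V] [FiniteDimensional 𝕜 V]
    [NormedAddCommGroup F] [NormedSpace 𝕜 F] [FiniteDimensional 𝕜 F] [Finite ι]
    {θ : E → V [⋀^ι]→L[𝕜] F} {x : E}
    (h : ∀ v : ι → V, DifferentiableAt 𝕜 (fun y => θ y v) x) : DifferentiableAt 𝕜 θ x := by
  classical
  have := Fintype.ofFinite ι
  let b := Module.finBasis 𝕜 V
  let coords : (V [⋀^ι]→L[𝕜] F) →ₗ[𝕜] ((ι → Fin (Module.finrank 𝕜 V)) → F) :=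
    LinearMap.pi fun w => (ContinuousAlternatingMap.apply 𝕜 V F fun i => b (w i)).toLinearMap
  have hker : LinearMap.ker coords = ⊥ := LinearMap.ker_eq_bot.mpr fun α β hαβ =>
    ContinuousAlternatingMap.toAlternatingMap_injective
      (b.ext_alternating fun w _ => congrFun hαβ w)
  obtain ⟨L, hL⟩ := LinearMap.exists_leftInverse_of_injective coords hker
  have hθ : θ = fun y => L.toContinuousLinearMap (coords (θ y)) :=
    funext fun y => (LinearMap.congr_fun hL (θ y)).symm
  rw [hθ]
  exact L.toContinuousLinearMap.differentiableAt.comp x (differentiableAt_pi.mpr fun w => h _)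

theorem exists_contMDiffSection_eq {E H M : Type*} [NormedAddCommGroup E] [NormedSpace ℝ E]
    [FiniteDimensional ℝ E] [TopologicalSpace H] (I : ModelWithCorners ℝ E H) [TopologicalSpace M]
    [ChartedSpace H M] [IsManifold I ∞ M] [T2Space M]
    (F : Type*) [NormedAddCommGroup F] [NormedSpace ℝ F]
    {V : M → Type*} [TopologicalSpace (TotalSpace F V)] [∀ x, TopologicalSpace (V x)]
    [∀ x, AddCommGroup (V x)] [∀ x, Module ℝ (V x)] [FiberBundle F V] [VectorBundle ℝ F V]
    [ContMDiffVectorBundle ∞ F V I] {p : M} (v : V p) :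
    ∃ s : ContMDiffSection I F ∞ V, s p = v := by
  obtain ⟨U, hU, hsmooth⟩ := FiberBundle.exists_contMDiffOn_extend I (k := ∞) F v
  obtain ⟨W, hWU, hW, hpW⟩ := mem_nhds_iff.mp hU
  obtain ⟨f, -, hf⟩ := (SmoothBumpFunction.nhds_basis_tsupport (I := I) p).mem_iff.mp
    (hW.mem_nhds hpW)
  refine ⟨⟨_, ContMDiffOn.smul_section_of_tsupport f.contMDiff.contMDiffOn hW hf
    (hsmooth.mono hWU)⟩, ?_⟩
  change f p • FiberBundle.extend F v p = v
  rw [f.eq_one, one_smul, FiberBundle.extend_apply_self]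

section Chart

variable {n : ℕ} {M : Type*} [TopologicalSpace M] [ChartedSpace (EuclideanSpace ℝ (Fin n)) M]

/-- The representative of a vector field in the chart at `p`. -/
noncomputable def chartVectorField (p : M) (V : ∀ q : M, TangentSpace (𝓡 n) q) :
    EuclideanSpace ℝ (Fin n) → EuclideanSpace ℝ (Fin n) :=
  VectorField.mpullback 𝓘(ℝ, EuclideanSpace ℝ (Fin n)) (𝓡 n) (extChartAt (𝓡 n) p).symm V

/-- The representative of a differential form in the chart at `p`, as used in `formExtDeriv`. -/
noncomputable def chartForm {k : ℕ} (p : M)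
    (θ : ∀ q : M, TangentSpace (𝓡 n) q [⋀^Fin k]→L[ℝ] ℝ) (y : EuclideanSpace ℝ (Fin n)) :
    EuclideanSpace ℝ (Fin n) [⋀^Fin k]→L[ℝ] ℝ :=
  (θ ((extChartAt (𝓡 n) p).symm y)).compContinuousLinearMap
    (mfderiv (𝓡 n) (𝓡 n) (extChartAt (𝓡 n) p).symm y)

/-- Differentiability at `p` of a vector field, as a section of the tangent bundle. -/
abbrev MDifferentiableFieldAt [IsManifold (𝓡 n) 1 M] (V : ∀ q : M, TangentSpace (𝓡 n) q) (p : M) :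
    Prop :=
  MDifferentiableAt (𝓡 n) ((𝓡 n).prod 𝓘(ℝ, EuclideanSpace ℝ (Fin n)))
    (fun q => (⟨q, V q⟩ : TangentBundle (𝓡 n) M)) p

/-- Differentiability at `p` of a differential form, tested on vector fields that are
differentiable at `p`; this avoids a bundle structure on alternating forms. -/
def MDifferentiableFormAt [IsManifold (𝓡 n) 1 M] {k : ℕ}
    (θ : ∀ q : M, TangentSpace (𝓡 n) q [⋀^Fin k]→L[ℝ] ℝ) (p : M) : Prop :=
  ∀ V : Fin k → ∀ q : M, TangentSpace (𝓡 n) q, (∀ i, MDifferentiableFieldAt (V i) p) →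
    MDifferentiableAt (𝓡 n) 𝓘(ℝ, ℝ) (fun q => θ q (V · q)) p

theorem differentiableAt_comp_extChartAt_symm {p : M} {f : M → ℝ}
    (hf : MDifferentiableAt (𝓡 n) 𝓘(ℝ, ℝ) f p) :
    DifferentiableAt ℝ (f ∘ (extChartAt (𝓡 n) p).symm) (extChartAt (𝓡 n) p p) := by
  have h := hf.differentiableWithinAt_writtenInExtChartAt
  rw [ModelWithCorners.range_eq_univ] at h
  exact h.differentiableAt Filter.univ_mem

theorem dirDeriv_eq_fderiv {p : M} {f : M → ℝ}
    (hf : MDifferentiableAt (𝓡 n) 𝓘(ℝ, ℝ) f p) (v : TangentSpace (𝓡 n) p) :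
    AlmostContactMetric.dirDeriv f p v
      = fderiv ℝ (f ∘ (extChartAt (𝓡 n) p).symm) (extChartAt (𝓡 n) p p) v := by
  rw [AlmostContactMetric.dirDeriv, hf.mfderiv, ModelWithCorners.range_eq_univ, fderivWithin_univ]
  rfl

theorem AlmostContactMetric.dirDeriv_const (c : ℝ) (p : M) (v : TangentSpace (𝓡 n) p) :
    dirDeriv (fun _ : M => c) p v = 0 := by
  rw [dirDeriv, mfderiv_const]
  rfl

variable [IsManifold (𝓡 n) 1 M]

theorem mfderiv_extChartAt_symm_chartVectorField {p : M} (V : ∀ q : M, TangentSpace (𝓡 n) q)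
    {y : EuclideanSpace ℝ (Fin n)} (hy : y ∈ (extChartAt (𝓡 n) p).target) :
    mfderiv (𝓡 n) (𝓡 n) (extChartAt (𝓡 n) p).symm y (chartVectorField p V y)
      = V ((extChartAt (𝓡 n) p).symm y) := by
  have hinv := isInvertible_mfderivWithin_extChartAt_symm (I := 𝓡 n) hy
  rw [ModelWithCorners.range_eq_univ, mfderivWithin_univ] at hinv
  exact hinv.self_apply_inverse (V ((extChartAt (𝓡 n) p).symm y))

theorem mfderiv_extChartAt_symm_self (p : M) (v : EuclideanSpace ℝ (Fin n)) :
    mfderiv (𝓡 n) (𝓡 n) (extChartAt (𝓡 n) p).symm (extChartAt (𝓡 n) p p) v = v := by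
  have h := mfderivWithin_range_extChartAt_symm (I := 𝓡 n) (x := p)
  rw [ModelWithCorners.range_eq_univ, mfderivWithin_univ] at h
  exact congrArg (fun L : EuclideanSpace ℝ (Fin n) →L[ℝ] EuclideanSpace ℝ (Fin n) => L v) h

theorem chartVectorField_self (p : M) (V : ∀ q : M, TangentSpace (𝓡 n) q) :
    chartVectorField p V (extChartAt (𝓡 n) p p) = V p := by
  have h := mfderiv_extChartAt_symm_chartVectorField V (mem_extChartAt_target (I := 𝓡 n) p)
  have hV : V ((extChartAt (𝓡 n) p).symm (extChartAt (𝓡 n) p p))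
      = (V p : EuclideanSpace ℝ (Fin n)) := by rw [extChartAt_to_inv]
  exact (mfderiv_extChartAt_symm_self p _).symm.trans (h.trans hV)

theorem chartForm_chartVectorField {k : ℕ} {p : M}
    (θ : ∀ q : M, TangentSpace (𝓡 n) q [⋀^Fin k]→L[ℝ] ℝ)
    (V : Fin k → ∀ q : M, TangentSpace (𝓡 n) q)
    {y : EuclideanSpace ℝ (Fin n)} (hy : y ∈ (extChartAt (𝓡 n) p).target) :
    chartForm p θ y (fun i => chartVectorField p (V i) y)
      = θ ((extChartAt (𝓡 n) p).symm y) fun i => V i ((extChartAt (𝓡 n) p).symm y) :=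
  congrArg (θ _) (funext fun i => mfderiv_extChartAt_symm_chartVectorField (V i) hy)

theorem chartForm_self {k : ℕ} (p : M) (θ : ∀ q : M, TangentSpace (𝓡 n) q [⋀^Fin k]→L[ℝ] ℝ)
    (v : Fin k → TangentSpace (𝓡 n) p) :
    chartForm p θ (extChartAt (𝓡 n) p p) v = θ p v := by
  have hbase : ∀ (q : M) (_ : q = p) (w : Fin k → EuclideanSpace ℝ (Fin n)), θ q w = θ p w := by
    rintro q rfl w
    rfl
  exact (congrArg (θ _) (funext fun i => mfderiv_extChartAt_symm_self p (v i))).trans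
    (hbase _ (extChartAt_to_inv (I := 𝓡 n) p) v)

theorem mlieBracket_eq_lieBracket_chartVectorField (p : M) (V W : ∀ q : M, TangentSpace (𝓡 n) q) :
    VectorField.mlieBracket (𝓡 n) V W p = VectorField.lieBracket ℝ (chartVectorField p V)
      (chartVectorField p W) (extChartAt (𝓡 n) p p) := by
  rw [← VectorField.mlieBracketWithin_univ, VectorField.mlieBracketWithin_apply,
    mfderiv_extChartAt_self, Set.preimage_univ, Set.univ_inter, ModelWithCorners.range_eq_univ,
    VectorField.mpullbackWithin_univ, VectorField.mpullbackWithin_univ]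
  change ContinuousLinearMap.inverse (ContinuousLinearMap.id ℝ (EuclideanSpace ℝ (Fin n))) _ = _
  rw [ContinuousLinearMap.inverse_id]
  change VectorField.lieBracketWithin ℝ (chartVectorField p V) (chartVectorField p W) Set.univ _ = _
  rw [VectorField.lieBracketWithin_univ]

theorem extend_eq_mfderiv_extChartAt_symm {p : M} (v : TangentSpace (𝓡 n) p)
    {y : EuclideanSpace ℝ (Fin n)} (hy : y ∈ (extChartAt (𝓡 n) p).target) :
    FiberBundle.extend (EuclideanSpace ℝ (Fin n)) v ((extChartAt (𝓡 n) p).symm y)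
      = mfderiv (𝓡 n) (𝓡 n) (extChartAt (𝓡 n) p).symm y v := by
  let t := trivializationAt (EuclideanSpace ℝ (Fin n)) (TangentSpace (𝓡 n) (M := M)) p
  have hq : (extChartAt (𝓡 n) p).symm y ∈ (chartAt (EuclideanSpace ℝ (Fin n)) p).source := by
    simpa using (extChartAt (𝓡 n) p).map_target hy
  have hsymm := TangentBundle.symmL_trivializationAt (I := 𝓡 n) hq
  rw [ModelWithCorners.range_eq_univ, mfderivWithin_univ, (extChartAt (𝓡 n) p).right_inv hy]
    at hsymm
  have hcoord := TangentBundle.continuousLinearMapAt_trivializationAt (I := 𝓡 n) (x := p) (x₀ := p)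
    (mem_chart_source _ p)
  rw [mfderiv_extChartAt_self] at hcoord
  have hv : (t ⟨p, v⟩).2 = v := by
    have h := congrArg (fun L : TangentSpace (𝓡 n) p →L[ℝ] EuclideanSpace ℝ (Fin n) => L v) hcoord
    rwa [Trivialization.continuousLinearMapAt_apply, Trivialization.coe_linearMapAt_of_mem _
      (FiberBundle.mem_baseSet_trivializationAt' p)] at h
  rw [FiberBundle.extend, hv]
  exact (Trivialization.symmL_apply (R := ℝ) t hq v).symm.trans
    (congrArg (fun L : EuclideanSpace ℝ (Fin n) →L[ℝ] EuclideanSpace ℝ (Fin n) => L v) hsymm)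

theorem formExtDeriv_apply {k : ℕ} (θ : ∀ q : M, TangentSpace (𝓡 n) q [⋀^Fin k]→L[ℝ] ℝ) (p : M)
    (v : Fin (k + 1) → TangentSpace (𝓡 n) p) :
    formExtDeriv θ p v = extDeriv (chartForm p θ) (extChartAt (𝓡 n) p p) v := by
  rw [formExtDeriv, mfderiv_extChartAt_self]
  rfl

namespace MDifferentiableFormAt

variable {k : ℕ} {p : M}

theorem differentiableAt_chartForm {θ : ∀ q : M, TangentSpace (𝓡 n) q [⋀^Fin k]→L[ℝ] ℝ}
    (hθ : MDifferentiableFormAt θ p) :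
    DifferentiableAt ℝ (chartForm p θ) (extChartAt (𝓡 n) p p) := by
  refine differentiableAt_continuousAlternatingMap_of_apply
    fun v : Fin k → TangentSpace (𝓡 n) p => ?_
  have hv := hθ (fun i => FiberBundle.extend (EuclideanSpace ℝ (Fin n)) (v i)) fun i =>
    FiberBundle.mdifferentiableAt_extend (𝓡 n) (EuclideanSpace ℝ (Fin n)) (v i)
  refine (differentiableAt_comp_extChartAt_symm hv).congr_of_eventuallyEq ?_
  filter_upwards [extChartAt_target_mem_nhds (I := 𝓡 n) p] with y hy
  exact congrArg (θ _) (funext fun i => (extend_eq_mfderiv_extChartAt_symm (v i) hy).symm)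

theorem fderiv_chartForm {θ : ∀ q : M, TangentSpace (𝓡 n) q [⋀^Fin k]→L[ℝ] ℝ}
    (hθ : MDifferentiableFormAt θ p) {V : Fin k → ∀ q : M, TangentSpace (𝓡 n) q}
    (hV : ∀ i, MDifferentiableFieldAt (V i) p) (v : TangentSpace (𝓡 n) p) :
    fderiv ℝ (fun y => chartForm p θ y fun i => chartVectorField p (V i) y)
        (extChartAt (𝓡 n) p p) v =
      AlmostContactMetric.dirDeriv (fun q => θ q (V · q)) p v := by
  have hchart : (fun y => chartForm p θ y fun i => chartVectorField p (V i) y)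
      =ᶠ[nhds (extChartAt (𝓡 n) p p)] (fun q => θ q (V · q)) ∘ (extChartAt (𝓡 n) p).symm := by
    filter_upwards [extChartAt_target_mem_nhds (I := 𝓡 n) p] with y hy
    exact chartForm_chartVectorField θ V hy
  rw [dirDeriv_eq_fderiv (hθ V hV), hchart.fderiv_eq]

end MDifferentiableFormAt

end Chart

section Bracket

variable {n : ℕ} {M : Type*} [TopologicalSpace M] [ChartedSpace (EuclideanSpace ℝ (Fin n)) M]
  [IsManifold (𝓡 n) 2 M]

theorem differentiableAt_chartVectorField {p : M} {V : ∀ q : M, TangentSpace (𝓡 n) q}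
    (hV : MDifferentiableFieldAt V p) :
    DifferentiableAt ℝ (chartVectorField p V) (extChartAt (𝓡 n) p p) := by
  have h := (mdifferentiableWithinAt_univ.mpr
    hV).differentiableWithinAt_mpullbackWithin_vectorField
  rw [Set.preimage_univ, Set.univ_inter, ModelWithCorners.range_eq_univ,
    VectorField.mpullbackWithin_univ] at h
  exact h.differentiableAt Filter.univ_mem

theorem formExtDeriv_apply_vectorField {k : ℕ} {p : M}
    {θ : ∀ q : M, TangentSpace (𝓡 n) q [⋀^Fin (k + 1)]→L[ℝ] ℝ} (hθ : MDifferentiableFormAt θ p)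
    {V : Fin (k + 2) → ∀ q : M, TangentSpace (𝓡 n) q} (hV : ∀ i, MDifferentiableFieldAt (V i) p) :
    formExtDeriv θ p (V · p) =
      (∑ i, (-1) ^ i.val •
        AlmostContactMetric.dirDeriv (fun q => θ q (i.removeNth (V · q))) p (V i p)) -
      ∑ i : Fin (k + 1), ∑ j ≥ i, (-1) ^ (i + j : ℕ) •
        θ p (Matrix.vecCons (VectorField.mlieBracket (𝓡 n) (V i.castSucc) (V j.succ) p)
          (j.removeNth <| i.castSucc.removeNth (V · p))) := by
  have hself : (fun i => chartVectorField p (V i) (extChartAt (𝓡 n) p p)) = (V · p) :=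
    funext fun i => chartVectorField_self p (V i)
  have h := extDeriv_apply_vectorField hθ.differentiableAt_chartForm
    fun i => differentiableAt_chartVectorField (hV i)
  rw [hself] at h
  rw [formExtDeriv_apply, h]
  congr 1
  · refine Finset.sum_congr rfl fun i _ => congrArg _ ?_
    rw [chartVectorField_self]
    exact hθ.fderiv_chartForm (fun j => hV (i.succAbove j)) (V i p)
  · refine Finset.sum_congr rfl fun i _ => Finset.sum_congr rfl fun j _ => congrArg _ ?_
    rw [mlieBracket_eq_lieBracket_chartVectorField]
    exact chartForm_self p θ _

theorem formExtDeriv_apply_vecThree {p : M}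
    {θ : ∀ q : M, TangentSpace (𝓡 n) q [⋀^Fin 2]→L[ℝ] ℝ} (hθ : MDifferentiableFormAt θ p)
    {X Y Z : ∀ q : M, TangentSpace (𝓡 n) q} (hX : MDifferentiableFieldAt X p)
    (hY : MDifferentiableFieldAt Y p) (hZ : MDifferentiableFieldAt Z p) :
    formExtDeriv θ p ![X p, Y p, Z p] =
      AlmostContactMetric.dirDeriv (fun q => θ q ![Y q, Z q]) p (X p)
        - AlmostContactMetric.dirDeriv (fun q => θ q ![X q, Z q]) p (Y p)
        + AlmostContactMetric.dirDeriv (fun q => θ q ![X q, Y q]) p (Z p)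
        - θ p ![VectorField.mlieBracket (𝓡 n) X Y p, Z p]
        + θ p ![VectorField.mlieBracket (𝓡 n) X Z p, Y p]
        - θ p ![VectorField.mlieBracket (𝓡 n) Y Z p, X p] := by
  let V : Fin 3 → ∀ q : M, TangentSpace (𝓡 n) q := ![X, Y, Z]
  have hV : ∀ i, MDifferentiableFieldAt (V i) p
    | 0 => hX
    | 1 => hY
    | 2 => hZ
  have hVp : (V · p) = ![X p, Y p, Z p] := by ext i : 1; fin_cases i <;> rfl
  have remove0 : ∀ q, (0 : Fin 3).removeNth (V · q) = ![Y q, Z q] := fun q => by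
    ext i : 1; fin_cases i <;> rfl
  have remove1 : ∀ q, (1 : Fin 3).removeNth (V · q) = ![X q, Z q] := fun q => by
    ext i : 1; fin_cases i <;> rfl
  have remove2 : ∀ q, (2 : Fin 3).removeNth (V · q) = ![X q, Y q] := fun q => by
    ext i : 1; fin_cases i <;> rfl
  have remove01 : (0 : Fin 2).removeNth ((0 : Fin 2).castSucc.removeNth ![X p, Y p, Z p]) =
      ![Z p] := by
    ext i : 1; fin_cases i; rfl
  have remove02 : (1 : Fin 2).removeNth ((0 : Fin 2).castSucc.removeNth ![X p, Y p, Z p]) =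
      ![Y p] := by
    ext i : 1; fin_cases i; rfl
  have remove12 : (1 : Fin 2).removeNth ((1 : Fin 2).castSucc.removeNth ![X p, Y p, Z p]) =
      ![X p] := by
    ext i : 1; fin_cases i; rfl
  have Ici_zero : Finset.Ici (0 : Fin 2) = {0, 1} := by decide
  have Ici_one : Finset.Ici (1 : Fin 2) = {1} := by decide
  have h := formExtDeriv_apply_vectorField hθ hV
  rw [Fin.sum_univ_three, Fin.sum_univ_two, Ici_zero, Ici_one, Finset.sum_pair (by decide),
    Finset.sum_singleton] at h
  simp only [remove0, remove1, remove2, remove01, remove02, remove12, hVp, Fin.val_zero,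
    Fin.val_one, Fin.val_two, add_zero, zero_add, one_add_one_eq_two, pow_zero, pow_one,
    neg_one_sq, one_smul, neg_smul] at h
  refine h.trans ?_
  simp only [sub_eq_add_neg, neg_add, neg_neg, add_assoc]
  rfl

theorem formExtDeriv_apply_of_apply_left_eq_zero {p : M}
    {θ : ∀ q : M, TangentSpace (𝓡 n) q [⋀^Fin 2]→L[ℝ] ℝ} (hθ : MDifferentiableFormAt θ p)
    {X Y Z : ∀ q : M, TangentSpace (𝓡 n) q} (hX : MDifferentiableFieldAt X p)
    (hY : MDifferentiableFieldAt Y p) (hZ : MDifferentiableFieldAt Z p)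
    (hXθ : ∀ q U, θ q ![X q, U] = 0) :
    formExtDeriv θ p ![X p, Y p, Z p] =
      AlmostContactMetric.dirDeriv (fun q => θ q ![Y q, Z q]) p (X p)
        - θ p ![VectorField.mlieBracket (𝓡 n) X Y p, Z p]
        - θ p ![Y p, VectorField.mlieBracket (𝓡 n) X Z p] := by
  have hswap : ∀ U W, θ p ![U, W] = -θ p ![W, U] := map_vecTwo_swap (θ p).toAlternatingMap
  rw [formExtDeriv_apply_vecThree hθ hX hY hZ, hswap _ (X p), hXθ, hswap _ (Y p)]
  simp only [hXθ, AlmostContactMetric.dirDeriv_const]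
  ring

end Bracket

namespace AlmostContactMetric

variable {n : ℕ} {M : Type*} [TopologicalSpace M]
  [ChartedSpace (EuclideanSpace ℝ (Fin n)) M] [IsManifold (𝓡 n) ∞ M]

/-- The smooth vector field `φ X`, bundled so that normality and the Killing equation apply to
it. -/
noncomputable def φField (A : AlmostContactMetric n M)
    (X : ContMDiffSection (𝓡 n) (EuclideanSpace ℝ (Fin n)) ∞
      (fun p : M => TangentSpace (𝓡 n) p)) :
    ContMDiffSection (𝓡 n) (EuclideanSpace ℝ (Fin n)) ∞ (fun p : M => TangentSpace (𝓡 n) p) :=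
  ⟨fun q => A.φ q (X q), A.φ.contMDiff.clm_bundle_apply X.contMDiff⟩

theorem mdifferentiableFormAt_F (A : AlmostContactMetric n M) (p : M) :
    MDifferentiableFormAt A.F p := by
  intro V hV
  have hφ : MDifferentiableFieldAt (fun q => A.φ q (V 0 q)) p :=
    A.φ.mdifferentiableAt.clm_bundle_apply (hV 0)
  have hg := A.g.contMDiff.mdifferentiableAt (x := p) (by simp)
  have hF := MDifferentiableAt.clm_bundle_apply₂ (F₃ := ℝ) (E₃ := Bundle.Trivial M ℝ) hg hφ (hV 1)
  exact ((mdifferentiableAt_totalSpace _ _).mp hF).2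

theorem IsKillingReeb.inner_ξ_mlieBracket_φField {A : AlmostContactMetric n M}
    (hA : A.IsKillingReeb) (Y : ContMDiffSection (𝓡 n) (EuclideanSpace ℝ (Fin n)) ∞
      (fun p : M => TangentSpace (𝓡 n) p)) (p : M) :
    A.g.inner p (A.ξ p) (VectorField.mlieBracket (𝓡 n) A.ξ (A.φField Y) p) = 0 := by
  have h := hA A.ξ (A.φField Y) p
  have hηφ : (fun q => A.g.inner q (A.ξ q) (A.φField Y q)) = fun _ => (0 : ℝ) :=
    funext fun q => A.η_φ q (Y q)
  rw [hηφ, dirDeriv_const, VectorField.mlieBracket_self] at h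
  simpa using h

theorem IsST.mlieBracket_ξ_φField {A : AlmostContactMetric n M} (hA : A.IsST)
    (Y : ContMDiffSection (𝓡 n) (EuclideanSpace ℝ (Fin n)) ∞
      (fun p : M => TangentSpace (𝓡 n) p)) (p : M) :
    VectorField.mlieBracket (𝓡 n) A.ξ (A.φField Y) p
      = A.φ p (VectorField.mlieBracket (𝓡 n) A.ξ Y p) := by
  have hξ : (fun q => A.φ q (A.ξ q)) = (0 : ∀ q : M, TangentSpace (𝓡 n) q) := funext A.φ_ξ
  have hnormal := hA.normal A.ξ Y p
  rw [sasakiHatakeyama, hξ, VectorField.mlieBracket_zero_left, VectorField.mlieBracket_zero_left,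
    Pi.zero_apply, map_zero, zero_add, sub_zero] at hnormal
  have hη : A.g.inner p (A.ξ p)
      (VectorField.mlieBracket (𝓡 n) A.ξ (fun q => A.φ q (Y q)) p) = 0 :=
    hA.killing.inner_ξ_mlieBracket_φField Y p
  have h := congrArg (A.φ p) hnormal
  rw [map_add, map_sub, map_smul, A.φ_ξ, smul_zero, add_zero, map_zero, A.φ_sq p (A.φ p _),
    A.φ_sq, A.η_φ, hη, zero_smul, add_zero, add_zero, sub_neg_eq_add, neg_add_eq_zero] at h
  exact h.symm

theorem IsST.dF_ξ [T2Space M] {A : AlmostContactMetric n M} (hA : A.IsST) (p : M)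
    (Y Z : TangentSpace (𝓡 n) p) : A.dF p ![A.ξ p, Y, Z] = 0 := by
  obtain ⟨Y, rfl⟩ := exists_contMDiffSection_eq (𝓡 n) (EuclideanSpace ℝ (Fin n)) Y
  obtain ⟨Z, rfl⟩ := exists_contMDiffSection_eq (𝓡 n) (EuclideanSpace ℝ (Fin n)) Z
  have hξF : ∀ q U, A.F q ![A.ξ q, U] = 0 := fun q U => by
    rw [F_vecTwo, A.φ_ξ, map_zero, zero_apply]
  calc A.dF p ![A.ξ p, Y p, Z p]
      = dirDeriv (fun q => A.F q ![Y q, Z q]) p (A.ξ p)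
        - A.F p ![VectorField.mlieBracket (𝓡 n) A.ξ Y p, Z p]
        - A.F p ![Y p, VectorField.mlieBracket (𝓡 n) A.ξ Z p] :=
        formExtDeriv_apply_of_apply_left_eq_zero (A.mdifferentiableFormAt_F p)
          A.ξ.mdifferentiableAt Y.mdifferentiableAt Z.mdifferentiableAt hξF
    _ = dirDeriv (fun q => A.g.inner q (A.φField Y q) (Z q)) p (A.ξ p)
        - A.g.inner p (VectorField.mlieBracket (𝓡 n) A.ξ (A.φField Y) p) (Z p)
        - A.g.inner p (A.φField Y p) (VectorField.mlieBracket (𝓡 n) A.ξ Z p) := by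
        rw [hA.mlieBracket_ξ_φField]
        rfl
    _ = 0 := hA.killing (A.φField Y) Z p

end AlmostContactMetric

theorem mainTheorem9_general {M : Type*} [TopologicalSpace M]
    [ChartedSpace (EuclideanSpace ℝ (Fin 5)) M] [IsManifold (𝓡 5) ∞ M]
    (A : AlmostContactMetric 5 M)
    (hξ : ∀ (p : M) (Y Z : TangentSpace (𝓡 5) p), A.dF p ![A.ξ p, Y, Z] = 0) :
    (∀ (p : M) (X Y Z : TangentSpace (𝓡 5) p),
        A.dF p ![X, Y, Z] = wedgeOneTwo (A.leeForm p) (fun U V => A.F p ![U, V]) X Y Z) ∧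
      (A.IsBalanced ↔ ∀ p : M, A.dF p = 0) := by
  have hwedge := fun p => AlmostContactMetric.dF_eq_wedgeOneTwo_leeForm (hξ p)
  refine ⟨hwedge, fun hbalanced p => ?_, fun hclosed p X => ?_⟩
  · ext v
    have hv : v = ![v 0, v 1, v 2] := by ext i : 1; fin_cases i <;> rfl
    rw [hv, hwedge]
    simp [wedgeOneTwo, hbalanced p]
  · obtain ⟨e, he⟩ := A.exists_isOrthonormalFrameAt p
    simp [A.leeForm_eq_half_sum_dF p (hξ p) X he, hclosed p]

theorem mainTheorem9 {M : Type*} [TopologicalSpace M] [T2Space M]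
    [ChartedSpace (EuclideanSpace ℝ (Fin 5)) M] [IsManifold (𝓡 5) ∞ M]
    (A : AlmostContactMetric 5 M) (hA : A.IsST) :
    (∀ (p : M) (X Y Z : TangentSpace (𝓡 5) p),
        A.dF p ![X, Y, Z] = wedgeOneTwo (A.leeForm p) (fun U V => A.F p ![U, V]) X Y Z) ∧
      (A.IsBalanced ↔ A.IsQuasiSasaki) := by
  obtain ⟨hwedge, hbalanced⟩ := mainTheorem9_general A hA.dF_ξ
  exact ⟨hwedge, hbalanced.trans ⟨fun h => ⟨hA.normal, h⟩, fun h => h.closed⟩⟩
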